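/- Let $\mathbb{D}$ be the open unit disc in $\mathbb{C}$ and let $A_{\mathbb{R}}(\mathbb{D})$ be the real algebra of all functions that are continuous on $\overline{\mathbb{D}}$, holomorphic in $\mathbb{D}$, and whose boundary values have only real Fourier coefficients; write $\|f\|_\infty=\sup_{z\in\overline{\mathbb{D}}}|f(z)|$. Let $f_1,f_2\in A_{\mathbb{R}}(\mathbb{D})$ satisfy $\|f_1\|_\infty\le 1$, $\|f_2\|_\infty\le 1$ and $$\inf_{z\in\overline{\mathbb{D}}}\bigl(|f_1(z)|+|f_2(z)|\bigr)\ge\delta>0 .$$ Suppose that $f_1$ has the same sign at all real zeros of $f_2$, that is, $f_1(x)$ and $f_1(y)$ (which are real numbers) have the same sign whenever $x,y\in[-1,1]$ and $f_2(x)=f_2(y)=0$. Then there exist $g_1,g_2\in A_{\mathbb{R}}(\mathbb{D})$, with $g_1$ invertible in $A_{\mathbb{R}}(\mathbb{D})$, such that $$f_1(z)g_1(z)+f_2(z)g_2(z)=1\qquad\text{for all } z\in\overline{\mathbb{D}} .$$ -/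

import Mathlib

open MeasureTheory Metric
open scoped ComplexConjugate

/-- The closed unit disc of `ℂ`, as a (compact) topological space. -/
abbrev ClosedDisc : Type := closedBall (0 : ℂ) 1

/-- Extension by `0` of a function on the closed disc to all of `ℂ`, used only to speak about
holomorphy in the open disc. -/
noncomputable def ClosedDisc.ext (f : ClosedDisc → ℂ) : ℂ → ℂ :=
  Function.extend Subtype.val f 0

theorem ClosedDisc.ext_apply (f : ClosedDisc → ℂ) (z : ClosedDisc) :
    ClosedDisc.ext f z = f z :=
  Subtype.val_injective.extend_apply f 0 z

/-- The disc algebra `A(𝔻)`: continuous functions on the closed unit disc that are holomorphic in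
the open unit disc. -/
noncomputable def discAlgebra : Subalgebra ℂ C(ClosedDisc, ℂ) where
  carrier := {f | DifferentiableOn ℂ (ClosedDisc.ext f) (ball 0 1)}
  mul_mem' {f g} hf hg := (DifferentiableOn.mul hf hg).congr fun z hz => by
    have h (k : ClosedDisc → ℂ) := ClosedDisc.ext_apply k ⟨z, ball_subset_closedBall hz⟩
    simp only [Pi.mul_apply] at h ⊢
    simp only [h, ContinuousMap.mul_apply]
  add_mem' {f g} hf hg := (DifferentiableOn.add hf hg).congr fun z hz => by
    have h (k : ClosedDisc → ℂ) := ClosedDisc.ext_apply k ⟨z, ball_subset_closedBall hz⟩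
    simp only [Pi.add_apply] at h ⊢
    simp only [h, ContinuousMap.add_apply]
  algebraMap_mem' c := (differentiableOn_const c).congr fun z hz => by
    have h (k : ClosedDisc → ℂ) := ClosedDisc.ext_apply k ⟨z, ball_subset_closedBall hz⟩
    simp only at h
    simp only [h]
    rfl

/-- The boundary point `exp (2πit)` of the closed disc, for `t ∈ ℝ/ℤ`. -/
noncomputable def ClosedDisc.bdryPoint (t : UnitAddCircle) : ClosedDisc :=
  ⟨(AddCircle.toCircle t : ℂ), mem_closedBall_zero_iff.2 (Circle.norm_coe _).le⟩

/-- The `n`-th Fourier coefficient of the boundary values of `f`. -/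
noncomputable def discFourierCoeff (f : C(ClosedDisc, ℂ)) (n : ℤ) : ℂ :=
  fourierCoeff (fun t : UnitAddCircle => f (ClosedDisc.bdryPoint t)) n

/-- Complex conjugation of the closed disc. -/
noncomputable def ClosedDisc.conj (z : ClosedDisc) : ClosedDisc :=
  ⟨starRingEnd ℂ z, by
    rw [mem_closedBall_zero_iff, RCLike.norm_conj]
    exact mem_closedBall_zero_iff.1 z.2⟩

/-- The reflected function `z ↦ conj (f (conj z))`. -/
noncomputable def discReflect (f : C(ClosedDisc, ℂ)) : C(ClosedDisc, ℂ) where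
  toFun z := starRingEnd ℂ (f (ClosedDisc.conj z))
  continuous_toFun := by
    unfold ClosedDisc.conj
    fun_prop

theorem discReflect_mem {f : C(ClosedDisc, ℂ)} (hf : f ∈ discAlgebra) :
    discReflect f ∈ discAlgebra := by
  have hf' : DifferentiableOn ℂ (ClosedDisc.ext f) (ball 0 1) := hf
  have key : DifferentiableOn ℂ (starRingEnd ℂ ∘ ClosedDisc.ext f ∘ starRingEnd ℂ)
      (ball 0 1) := by
    intro z hz
    have hz' : starRingEnd ℂ z ∈ ball (0 : ℂ) 1 := by simpa using hz
    have := (hf' _ hz').differentiableAt (isOpen_ball.mem_nhds hz')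
    exact (differentiableAt_conj_conj_iff.2 this).differentiableWithinAt
  refine key.congr fun z hz => ?_
  have h (k : ClosedDisc → ℂ) := ClosedDisc.ext_apply k ⟨z, ball_subset_closedBall hz⟩
  have h2 := ClosedDisc.ext_apply f (ClosedDisc.conj ⟨z, ball_subset_closedBall hz⟩)
  simp only [Function.comp_apply]
  exact (h _).trans (congrArg (starRingEnd ℂ) h2.symm)

theorem ClosedDisc.conj_bdryPoint (t : UnitAddCircle) :
    ClosedDisc.conj (ClosedDisc.bdryPoint t) = ClosedDisc.bdryPoint (-t) := by
  apply Subtype.ext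
  simp only [ClosedDisc.conj, ClosedDisc.bdryPoint, AddCircle.toCircle_neg,
    Circle.coe_inv_eq_conj]

theorem ClosedDisc.continuous_bdryPoint : Continuous ClosedDisc.bdryPoint :=
  Continuous.subtype_mk (continuous_subtype_val.comp AddCircle.continuous_toCircle) _

theorem discFourierCoeff_reflect (f : C(ClosedDisc, ℂ)) (n : ℤ) :
    discFourierCoeff (discReflect f) n = starRingEnd ℂ (discFourierCoeff f n) := by
  unfold discFourierCoeff fourierCoeff
  rw [← integral_conj, ← integral_neg_eq_self]
  refine integral_congr_ae (Filter.Eventually.of_forall fun t => ?_)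
  have h1 : discReflect f (ClosedDisc.bdryPoint (-t))
      = starRingEnd ℂ (f (ClosedDisc.bdryPoint t)) := by
    change starRingEnd ℂ (f (ClosedDisc.conj (ClosedDisc.bdryPoint (-t)))) = _
    rw [ClosedDisc.conj_bdryPoint, neg_neg]
  simp only [smul_eq_mul, map_mul, h1, ← fourier_neg, neg_neg]
  congr 1
  simp [fourier_apply]

/-- Continuous functions on the circle are determined by their Fourier coefficients. -/
theorem eq_of_fourierCoeff_eq {f g : C(UnitAddCircle, ℂ)}
    (h : ∀ n, fourierCoeff f n = fourierCoeff g n) : f = g := by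
  apply ContinuousMap.toLp_injective (𝕜 := ℂ) (p := 2) (AddCircle.haarAddCircle (T := 1))
  apply fourierBasis.repr.injective
  ext n
  rw [fourierBasis_repr, fourierBasis_repr, fourierCoeff_toLp, fourierCoeff_toLp, h]

/-- Elements of the disc algebra are determined by the Fourier coefficients of their boundary
values. -/
theorem eq_of_discFourierCoeff_eq {f g : C(ClosedDisc, ℂ)} (hf : f ∈ discAlgebra)
    (hg : g ∈ discAlgebra) (h : ∀ n, discFourierCoeff f n = discFourierCoeff g n) : f = g := by
  have hb : f.comp ⟨_, ClosedDisc.continuous_bdryPoint⟩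
      = g.comp ⟨_, ClosedDisc.continuous_bdryPoint⟩ := eq_of_fourierCoeff_eq h
  have dc (k : C(ClosedDisc, ℂ)) (hk : k ∈ discAlgebra) :
      DiffContOnCl ℂ (ClosedDisc.ext k) (ball 0 1) := by
    refine ⟨hk, ?_⟩
    rw [closure_ball _ one_ne_zero, continuousOn_iff_continuous_domRestrict]
    exact k.continuous.congr fun z => (ClosedDisc.ext_apply k z).symm
  have hfr : Set.EqOn (ClosedDisc.ext f) (ClosedDisc.ext g) (frontier (ball 0 1)) := by
    rw [frontier_ball _ one_ne_zero]
    intro z hz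
    obtain ⟨t, ht⟩ := (AddCircle.homeomorphCircle (T := 1) one_ne_zero).surjective
      ⟨z, hz⟩
    have hz' : z = (ClosedDisc.bdryPoint t : ℂ) := by
      have := congrArg (fun c : Circle => (c : ℂ)) ht
      simpa [ClosedDisc.bdryPoint, AddCircle.homeomorphCircle_apply] using this.symm
    rw [hz', ClosedDisc.ext_apply, ClosedDisc.ext_apply]
    exact DFunLike.congr_fun hb t
  have := Complex.eqOn_closure_of_eqOn_frontier isBounded_ball (dc f hf) (dc g hg) hfr
  rw [closure_ball _ one_ne_zero] at this
  ext z
  rw [← ClosedDisc.ext_apply f, ← ClosedDisc.ext_apply g]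
  exact this z.2

/-- An element of the disc algebra has real Fourier coefficients iff it is real symmetric,
`f z = conj (f (conj z))`. -/
theorem discFourierCoeff_real_iff {f : C(ClosedDisc, ℂ)} (hf : f ∈ discAlgebra) :
    (∀ n, (discFourierCoeff f n).im = 0) ↔
      ∀ z, f z = starRingEnd ℂ (f (ClosedDisc.conj z)) := by
  have hr (n : ℤ) : (discFourierCoeff f n).im = 0 ↔
      discFourierCoeff f n = discFourierCoeff (discReflect f) n := by
    rw [discFourierCoeff_reflect, eq_comm (a := discFourierCoeff f n), Complex.conj_eq_iff_im]
  constructor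
  · intro h z
    exact DFunLike.congr_fun
      (eq_of_discFourierCoeff_eq hf (discReflect_mem hf) fun n => (hr n).1 (h n)) z
  · intro h n
    have : f = discReflect f := ContinuousMap.ext h
    rw [hr, ← this]

/-- The real algebra `A_ℝ(𝔻)`: elements of the disc algebra all of whose Fourier coefficients are
real. -/
noncomputable def realDiscAlgebra : Subalgebra ℝ C(ClosedDisc, ℂ) where
  carrier := {f | f ∈ discAlgebra ∧ ∀ n : ℤ, (discFourierCoeff f n).im = 0}
  mul_mem' {f g} hf hg := by
    have h := mul_mem hf.1 hg.1
    refine ⟨h, (discFourierCoeff_real_iff h).2 fun z => ?_⟩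
    simp only [ContinuousMap.mul_apply, map_mul]
    rw [← (discFourierCoeff_real_iff hf.1).1 hf.2 z, ← (discFourierCoeff_real_iff hg.1).1 hg.2 z]
  add_mem' {f g} hf hg := by
    have h := add_mem hf.1 hg.1
    refine ⟨h, (discFourierCoeff_real_iff h).2 fun z => ?_⟩
    simp only [ContinuousMap.add_apply, map_add]
    rw [← (discFourierCoeff_real_iff hf.1).1 hf.2 z, ← (discFourierCoeff_real_iff hg.1).1 hg.2 z]
  algebraMap_mem' r := by
    have h : algebraMap ℝ C(ClosedDisc, ℂ) r ∈ discAlgebra :=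
      discAlgebra.algebraMap_mem (r : ℂ)
    refine ⟨h, (discFourierCoeff_real_iff h).2 fun z => ?_⟩
    exact (Complex.conj_ofReal r).symm

/-- `f₁` is POZ of `f₂` ("positive on real zeros"): `f₁`, which takes real values at real points,
has the same sign at all real zeros of `f₂` in the closed disc. -/
def IsPOZ (f₁ f₂ : realDiscAlgebra) : Prop :=
  ∀ x y : ClosedDisc, (x : ℂ).im = 0 → (y : ℂ).im = 0 → f₂.1 x = 0 → f₂.1 y = 0 →
    SignType.sign (f₁.1 x).re = SignType.sign (f₁.1 y).re

open Filter Topology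

/-! It suffices to make `f₁` congruent to a unit modulo `f₂` (`LiftsToUnit`): the inverse of that
unit serves as `g₁`. This property is multiplicative and, by a Bézout identity, locally constant
among functions having no common zero with `f₂` (`eventually_liftsToUnit_iff`). Hence `f₁` may be
replaced by a nearby real polynomial, whose roots may be moved as long as they avoid the zeros of
`f₂`; a root outside the closed disc contributes a unit.

A conjugate pair of roots always lifts (`liftsToUnit_quadraticFactor`): the pairs that fail would
fill an open set bounded by zeros of `f₂`, against the maximum principle. A single real root must
stay on the real line. It escapes if all real zeros of `f₂` lie on one side of it; otherwise the
sign condition supplies a second real root with no zero of `f₂` in between, and the two merge into a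
double root, a degenerate conjugate pair (`liftsToUnit_aeval_coord`). -/

theorem ClosedDisc.continuousOn_ext (f : C(ClosedDisc, ℂ)) :
    ContinuousOn (ClosedDisc.ext f) (closedBall 0 1) := by
  rw [continuousOn_iff_continuous_domRestrict]
  exact f.continuous.congr fun z => (ClosedDisc.ext_apply f z).symm

/-- Uniform limits of holomorphic functions are holomorphic. The resulting completeness gives access
to Gelfand theory. -/
theorem isClosed_discAlgebra : IsClosed (discAlgebra : Set C(ClosedDisc, ℂ)) := by
  refine isClosed_of_closure_subset fun f hf => ?_
  obtain ⟨u, hu, hlim⟩ := mem_closure_iff_seq_limit.1 hf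
  rw [ContinuousMap.tendsto_iff_tendstoUniformly] at hlim
  have hU : TendstoUniformlyOn (fun n => ClosedDisc.ext (u n)) (ClosedDisc.ext f) atTop
      (ball 0 1) := by
    intro s hs
    filter_upwards [hlim s hs] with n hn z hz
    have h (k : ClosedDisc → ℂ) := ClosedDisc.ext_apply k ⟨z, ball_subset_closedBall hz⟩
    simp only at h
    rw [h, h]
    exact hn _
  exact hU.tendstoLocallyUniformlyOn.differentiableOn (Eventually.of_forall hu) isOpen_ball

instance : CompleteSpace discAlgebra := isClosed_discAlgebra.completeSpace_coe

theorem mem_realDiscAlgebra_iff {f : C(ClosedDisc, ℂ)} :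
    f ∈ realDiscAlgebra ↔ f ∈ discAlgebra ∧ ∀ z, f z = conj (f (ClosedDisc.conj z)) :=
  and_congr_right discFourierCoeff_real_iff

/-! ### Density of polynomials -/

/-- The coordinate function of the closed disc. -/
def ClosedDisc.coord : C(ClosedDisc, ℂ) := ⟨Subtype.val, continuous_subtype_val⟩

theorem ClosedDisc.coord_mem_discAlgebra : ClosedDisc.coord ∈ discAlgebra :=
  differentiableOn_id.congr fun z hz =>
    ClosedDisc.ext_apply ClosedDisc.coord ⟨z, ball_subset_closedBall hz⟩

theorem ClosedDisc.coord_mem_realDiscAlgebra : ClosedDisc.coord ∈ realDiscAlgebra :=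
  mem_realDiscAlgebra_iff.2
    ⟨ClosedDisc.coord_mem_discAlgebra, fun z => (Complex.conj_conj (z : ℂ)).symm⟩

/-- The coordinate function as an element of the disc algebra. -/
def discAlgebra.coord : discAlgebra := ⟨ClosedDisc.coord, ClosedDisc.coord_mem_discAlgebra⟩

/-- The coordinate function as an element of the real disc algebra. -/
def realDiscAlgebra.coord : realDiscAlgebra :=
  ⟨ClosedDisc.coord, ClosedDisc.coord_mem_realDiscAlgebra⟩

theorem discAlgebra.aeval_coord_apply (p : Polynomial ℂ) (z : ClosedDisc) :
    (Polynomial.aeval discAlgebra.coord p).1 z = p.eval (z : ℂ) := by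
  let φ : discAlgebra →ₐ[ℂ] ℂ :=
    (ContinuousMap.evalAlgHom ℂ ℂ z).comp discAlgebra.val
  exact (Polynomial.aeval_algHom_apply φ discAlgebra.coord p).symm

theorem realDiscAlgebra.aeval_coord_apply (p : Polynomial ℝ) (z : ClosedDisc) :
    (Polynomial.aeval realDiscAlgebra.coord p).1 z = Polynomial.aeval (z : ℂ) p := by
  let φ : realDiscAlgebra →ₐ[ℝ] ℂ :=
    (ContinuousMap.evalAlgHom ℝ ℂ z).comp realDiscAlgebra.val
  exact (Polynomial.aeval_algHom_apply φ realDiscAlgebra.coord p).symm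

/-- The dilate `f (r z)` is uniformly close to `f` for `r` near `1`, and its Taylor sums converge
uniformly on the closed disc. -/
theorem exists_polynomial_near {f : C(ClosedDisc, ℂ)} (hf : f ∈ discAlgebra) {ε : ℝ}
    (hε : 0 < ε) : ∃ p : Polynomial ℂ, ∀ z : ClosedDisc, ‖f z - p.eval (z : ℂ)‖ < ε := by
  obtain ⟨η, hη, hf'⟩ := Metric.uniformContinuous_iff.1
    (CompactSpace.uniformContinuous_of_continuous f.continuous) (ε / 2) (half_pos hε)
  -- Dilation by `r` moves points by at most `1 - r < η`; the radii `r < r' < R < 1` leave room for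
  -- uniform convergence.
  obtain ⟨r, hr, hr1⟩ : ∃ r : ℝ, max 0 (1 - η) < r ∧ r < 1 :=
    exists_between (max_lt one_pos (by linarith))
  obtain ⟨r', hrr', hr'1⟩ := exists_between hr1
  obtain ⟨R, hr'R, hR1⟩ := exists_between hr'1
  have hr0 : 0 < r := (le_max_left _ _).trans_lt hr
  have hrη : 1 - η < r := (le_max_right _ _).trans_lt hr
  lift r' to NNReal using (hr0.trans hrr').le
  lift R to NNReal using ((hr0.trans hrr').trans hr'R).le
  have hR0 : 0 < R := (NNReal.coe_pos.1 (hr0.trans hrr')).trans (NNReal.coe_lt_coe.1 hr'R)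
  have hd : DifferentiableOn ℂ (ClosedDisc.ext f) (closedBall 0 R) :=
    DifferentiableOn.mono hf (closedBall_subset_ball hR1)
  have hT := (hd.hasFPowerSeriesOnBall hR0).tendstoUniformlyOn (r' := r')
    (by exact_mod_cast hr'R)
  rw [Metric.tendstoUniformlyOn_iff] at hT
  obtain ⟨n, hn⟩ := (hT (ε / 2) (half_pos hε)).exists
  set c := cauchyPowerSeries (ClosedDisc.ext f) 0 R
  refine ⟨∑ k ∈ Finset.range n, Polynomial.C (c.coeff k * (r : ℂ) ^ k) * Polynomial.X ^ k,
    fun z => ?_⟩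
  have hz : ‖(z : ℂ)‖ ≤ 1 := mem_closedBall_zero_iff.1 z.2
  have hrz : ‖(r : ℂ) * z‖ ≤ r := by
    rw [norm_mul, Complex.norm_real, Real.norm_of_nonneg hr0.le]
    exact mul_le_of_le_one_right hr0.le hz
  let w : ClosedDisc := ⟨r * z, mem_closedBall_zero_iff.2 (hrz.trans hr1.le)⟩
  have h1 : dist (f z) (f w) < ε / 2 := by
    apply hf'
    rw [Subtype.dist_eq, dist_eq_norm]
    have : (z : ℂ) - w = ((1 - r : ℝ) : ℂ) * z := by simp [w]; ring
    rw [this, norm_mul, Complex.norm_real, Real.norm_of_nonneg (by linarith)]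
    nlinarith [norm_nonneg (z : ℂ)]
  have h2 := hn (r * z) (mem_ball_zero_iff.2 (hrz.trans_lt hrr'))
  have h3 : c.partialSum n (r * z) = Polynomial.eval (z : ℂ)
      (∑ k ∈ Finset.range n, Polynomial.C (c.coeff k * (r : ℂ) ^ k) * Polynomial.X ^ k) := by
    simp only [FormalMultilinearSeries.partialSum, Polynomial.eval_finsetSum,
      FormalMultilinearSeries.apply_eq_pow_smul_coeff, Polynomial.eval_mul, Polynomial.eval_C,
      Polynomial.eval_pow, Polynomial.eval_X, smul_eq_mul]
    exact Finset.sum_congr rfl fun k _ => by ring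
  rw [zero_add, h3, show ClosedDisc.ext f (r * z) = f w from ClosedDisc.ext_apply f w] at h2
  rw [← dist_eq_norm]
  exact (dist_triangle _ _ _).trans_lt ((add_lt_add h1 h2).trans_eq (add_halves ε))

theorem ClosedDisc.conj_conj (z : ClosedDisc) : ClosedDisc.conj (ClosedDisc.conj z) = z :=
  Subtype.ext (Complex.conj_conj (z : ℂ))

theorem aeval_sum_monomial_re (p : Polynomial ℂ) (z : ℂ) :
    Polynomial.aeval z (∑ k ∈ p.support, Polynomial.monomial k (p.coeff k).re : Polynomial ℝ)
      = (p.eval z + conj (p.eval (conj z))) / 2 := by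
  simp only [Polynomial.eval_eq_sum, Polynomial.sum_def, map_sum, Polynomial.aeval_monomial,
    map_mul, map_pow, Complex.conj_conj, ← Finset.sum_add_distrib, Finset.sum_div, ← add_mul,
    Complex.add_conj]
  exact Finset.sum_congr rfl fun k _ => by simp; ring

theorem exists_real_polynomial_near (f : realDiscAlgebra) {ε : ℝ} (hε : 0 < ε) :
    ∃ p : Polynomial ℝ, ∀ z : ClosedDisc, ‖f.1 z - Polynomial.aeval (z : ℂ) p‖ < ε := by
  obtain ⟨hf, hsym⟩ := mem_realDiscAlgebra_iff.1 f.2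
  obtain ⟨p, hp⟩ := exists_polynomial_near hf hε
  refine ⟨∑ k ∈ p.support, Polynomial.monomial k (p.coeff k).re, fun z => ?_⟩
  rw [aeval_sum_monomial_re p z]
  have h1 := hp z
  have h2 := hp (ClosedDisc.conj z)
  rw [← Complex.norm_conj, map_sub, ← hsym z] at h2
  have : f.1 z - (p.eval (z : ℂ) + conj (p.eval (conj (z : ℂ)))) / 2
      = ((f.1 z - p.eval (z : ℂ)) + (f.1 z - conj (p.eval (conj (z : ℂ))))) / 2 := by ring
  rw [this, norm_div, Complex.norm_ofNat]
  have h2' : ‖f.1 z - conj (p.eval (conj (z : ℂ)))‖ < ε := h2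
  linarith [norm_add_le (f.1 z - p.eval (z : ℂ)) (f.1 z - conj (p.eval (conj (z : ℂ))))]

/-! ### Characters, Bézout identities and units -/

instance : Nonempty ClosedDisc := ⟨⟨0, mem_closedBall_self zero_le_one⟩⟩

instance : NormOneClass discAlgebra := ⟨norm_one (α := C(ClosedDisc, ℂ))⟩

/-- Characters are contractive, so the image of the coordinate is a point of the closed disc;
evaluation there agrees with `φ` on the dense polynomials. -/
theorem discAlgebra.exists_point_of_character
    (φ : discAlgebra →ₐ[ℂ] ℂ) :
    ∃ z : ClosedDisc, ∀ f : discAlgebra, φ f = f.1 z := by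
  have hle (f : discAlgebra) : ‖φ f‖ ≤ ‖f‖ :=
    AlgHom.norm_apply_le_self φ f
  have hz : φ discAlgebra.coord ∈ closedBall (0 : ℂ) 1 := by
    refine mem_closedBall_zero_iff.2 ((hle _).trans ?_)
    exact (ContinuousMap.norm_le _ zero_le_one).2 fun z => mem_closedBall_zero_iff.1 z.2
  refine ⟨⟨_, hz⟩, fun f => ?_⟩
  refine eq_of_forall_dist_le fun ε hε => ?_
  obtain ⟨p, hp⟩ := exists_polynomial_near f.2 (half_pos hε)
  have h1 : ‖φ (f - Polynomial.aeval discAlgebra.coord p)‖ ≤ ε / 2 := by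
    refine (hle _).trans ((ContinuousMap.norm_le _ (half_pos hε).le).2 fun z => ?_)
    have := (hp z).le
    rwa [← discAlgebra.aeval_coord_apply] at this
  have h2 := (hp ⟨_, hz⟩).le
  have h3 : φ (Polynomial.aeval discAlgebra.coord p) = p.eval (φ discAlgebra.coord) := by
    rw [← Polynomial.coe_aeval_eq_eval]
    exact (Polynomial.aeval_algHom_apply φ _ p).symm
  rw [map_sub, h3] at h1
  rw [← dist_eq_norm] at h1 h2
  linarith [dist_triangle_right (φ f) (f.1 ⟨_, hz⟩) (p.eval (φ discAlgebra.coord))]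

/-- A proper ideal lies in the kernel of a character, hence would give a common zero. -/
theorem discAlgebra.exists_bezout (f g : discAlgebra)
    (h : ∀ z, f.1 z = 0 → g.1 z ≠ 0) : ∃ a b : discAlgebra, f * a + g * b = 1 := by
  have htop : Ideal.span {f, g} = ⊤ := by
    by_contra hne
    obtain ⟨m, hm, hle⟩ := Ideal.exists_le_maximal _ hne
    obtain ⟨z, hz⟩ := discAlgebra.exists_point_of_character
      (WeakDual.CharacterSpace.toAlgHom m.toCharacterSpace)
    have h0 (k : discAlgebra) (hk : k ∈ ({f, g} : Set discAlgebra)) : k.1 z = 0 := by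
      rw [← hz]
      exact m.toCharacterSpace_apply_eq_zero_of_mem (hle (Ideal.subset_span hk))
    exact h z (h0 f (by simp)) (h0 g (by simp))
  obtain ⟨a, b, hab⟩ := Ideal.mem_span_pair.1 ((Ideal.eq_top_iff_one _).1 htop)
  exact ⟨a, b, by rw [mul_comm f, mul_comm g, hab]⟩

theorem exists_symmetrization (f : discAlgebra) :
    ∃ g : realDiscAlgebra, ∀ z, g.1 z = (f.1 z + conj (f.1 (ClosedDisc.conj z))) / 2 := by
  have h : (2⁻¹ : ℂ) • (f.1 + discReflect f.1) ∈ discAlgebra :=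
    discAlgebra.smul_mem (add_mem f.2 (discReflect_mem f.2)) _
  have hv (z : ClosedDisc) : ((2⁻¹ : ℂ) • (f.1 + discReflect f.1)) z
      = (f.1 z + conj (f.1 (ClosedDisc.conj z))) / 2 := by
    rw [div_eq_inv_mul]; rfl
  refine ⟨⟨_, mem_realDiscAlgebra_iff.2 ⟨h, fun z => ?_⟩⟩, hv⟩
  rw [hv, hv, ClosedDisc.conj_conj]
  simp [add_comm, map_ofNat]

/-- A complex solution averaged with its reflection is still a solution, since `f` and `g` are
symmetric. -/
theorem realDiscAlgebra.exists_bezout (f g : realDiscAlgebra)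
    (h : ∀ z, f.1 z = 0 → g.1 z ≠ 0) : ∃ a b : realDiscAlgebra, f * a + g * b = 1 := by
  obtain ⟨hf, hfs⟩ := mem_realDiscAlgebra_iff.1 f.2
  obtain ⟨hg, hgs⟩ := mem_realDiscAlgebra_iff.1 g.2
  obtain ⟨a, b, hab⟩ := discAlgebra.exists_bezout ⟨f.1, hf⟩ ⟨g.1, hg⟩ h
  obtain ⟨a', ha'⟩ := exists_symmetrization a
  obtain ⟨b', hb'⟩ := exists_symmetrization b
  have hv (z : ClosedDisc) : f.1 z * a.1 z + g.1 z * b.1 z = 1 :=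
    DFunLike.congr_fun (congrArg Subtype.val hab) z
  refine ⟨a', b', Subtype.ext (ContinuousMap.ext fun z => ?_)⟩
  change f.1 z * a'.1 z + g.1 z * b'.1 z = 1
  have h2 := congrArg conj (hv (ClosedDisc.conj z))
  simp only [map_add, map_mul, map_one, ← hfs, ← hgs] at h2
  rw [ha', hb']
  linear_combination (hv z + h2) / 2

theorem realDiscAlgebra.isUnit_of_forall_ne_zero (f : realDiscAlgebra) (h : ∀ z, f.1 z ≠ 0) :
    IsUnit f := by
  obtain ⟨a, b, hab⟩ := realDiscAlgebra.exists_bezout f 0 fun z hz => absurd hz (h z)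
  exact IsUnit.of_mul_eq_one a (by simpa using hab)

/-! ### Lifting to units modulo an element -/

/-- `f` is congruent to a unit modulo the principal ideal generated by `g`. -/
def LiftsToUnit {R : Type*} [CommRing R] (g f : R) : Prop := ∃ k, IsUnit (f + g * k)

namespace LiftsToUnit

variable {R : Type*} [CommRing R] {g f f' : R}

theorem of_isUnit (h : IsUnit f) : LiftsToUnit g f := ⟨0, by simpa using h⟩

theorem of_isUnit_modulus (h : IsUnit g) : LiftsToUnit g f := by
  obtain ⟨v, hv⟩ := h.exists_right_inv
  refine ⟨v * (1 - f), ?_⟩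
  rw [← mul_assoc, hv, one_mul, add_sub_cancel]
  exact isUnit_one

theorem mul (h : LiftsToUnit g f) (h' : LiftsToUnit g f') : LiftsToUnit g (f * f') := by
  obtain ⟨k, hk⟩ := h
  obtain ⟨k', hk'⟩ := h'
  refine ⟨f * k' + k * f' + g * k * k', ?_⟩
  convert hk.mul hk' using 1
  ring

theorem add_mul_iff (c : R) : LiftsToUnit g (f + g * c) ↔ LiftsToUnit g f :=
  ⟨fun ⟨k, hk⟩ => ⟨c + k, by rwa [mul_add, ← add_assoc]⟩,
    fun ⟨k, hk⟩ => ⟨k - c, by rwa [add_assoc, ← mul_add, add_sub_cancel]⟩⟩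

theorem mul_isUnit_iff {u : R} (hu : IsUnit u) : LiftsToUnit g (f * u) ↔ LiftsToUnit g f := by
  refine ⟨fun h => ?_, fun h => h.mul (of_isUnit hu)⟩
  obtain ⟨v, hv⟩ := hu.exists_right_inv
  have := h.mul (of_isUnit (IsUnit.of_mul_eq_one_right u hv))
  rwa [mul_assoc, hv, mul_one] at this

end LiftsToUnit

/-! ### Invariance of lifting under deformation -/

namespace realDiscAlgebra

theorem eventually_isUnit : ∀ᶠ h in 𝓝 (1 : realDiscAlgebra), IsUnit h := by
  filter_upwards [ball_mem_nhds (1 : realDiscAlgebra) one_pos] with h hh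
  refine isUnit_of_forall_ne_zero h fun z hz => ?_
  have h1 : ‖(h.1 - 1) z‖ < 1 :=
    ((h.1 - 1).norm_coe_le_norm z).trans_lt (mem_ball_iff_norm.1 hh)
  rw [ContinuousMap.sub_apply, hz, ContinuousMap.one_apply, zero_sub, norm_neg, norm_one] at h1
  exact lt_irrefl _ h1

/-- If `f * a + g * b = 1`, then `f' ≡ f * (1 + (f' - f) * a)` modulo `g`, and the second factor is
a unit for `f'` near `f`. -/
theorem eventually_liftsToUnit_iff {f g : realDiscAlgebra} (h : ∀ z, f.1 z = 0 → g.1 z ≠ 0) :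
    ∀ᶠ f' in 𝓝 f, (LiftsToUnit g f' ↔ LiftsToUnit g f) := by
  obtain ⟨a, b, hab⟩ := exists_bezout f g h
  have hlim : Tendsto (fun f' => 1 + (f' - f) * a) (𝓝 f) (𝓝 1) := by
    have : Continuous fun f' : realDiscAlgebra => 1 + (f' - f) * a := by fun_prop
    simpa using this.tendsto f
  filter_upwards [hlim.eventually eventually_isUnit] with f' hu
  rw [← LiftsToUnit.mul_isUnit_iff (f := f) hu,
    ← LiftsToUnit.add_mul_iff (f := f') (f * b - f' * b)]
  have : f' + g * (f * b - f' * b) = f * (1 + (f' - f) * a) := by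
    linear_combination (f - f') * hab
  rw [this]

theorem liftsToUnit_iff_of_isPreconnected {X : Type*} [TopologicalSpace X] {s : Set X}
    (hs : IsPreconnected s) {γ : X → realDiscAlgebra} (hγ : Continuous γ) {g : realDiscAlgebra}
    (h : ∀ x ∈ s, ∀ z, (γ x).1 z = 0 → g.1 z ≠ 0) {x y : X} (hx : x ∈ s) (hy : y ∈ s) :
    LiftsToUnit g (γ x) ↔ LiftsToUnit g (γ y) := by
  refine hs.induction₂ (fun x y => LiftsToUnit g (γ x) ↔ LiftsToUnit g (γ y)) (fun x hx => ?_)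
    (fun _ _ _ _ _ _ => Iff.trans) (fun _ _ _ _ => Iff.symm) hx hy
  exact nhdsWithin_le_nhds ((hγ.tendsto x).eventually
    ((eventually_liftsToUnit_iff (h x hx)).mono fun _ => Iff.symm))

/-! ### Linear and quadratic factors -/

/-- The zeros of `g` in the closed disc, as a subset of the plane. -/
def zeroLocus (g : realDiscAlgebra) : Set ℂ := Subtype.val '' {z : ClosedDisc | g.1 z = 0}

theorem coe_mem_zeroLocus {g : realDiscAlgebra} {z : ClosedDisc} :
    (z : ℂ) ∈ zeroLocus g ↔ g.1 z = 0 :=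
  Subtype.val_injective.mem_set_image

theorem isClosed_zeroLocus (g : realDiscAlgebra) : IsClosed (zeroLocus g) :=
  ((isClosed_eq g.1.continuous continuous_const).isCompact.image continuous_subtype_val).isClosed

theorem conj_mem_zeroLocus {g : realDiscAlgebra} {a : ℂ} (ha : a ∈ zeroLocus g) :
    conj a ∈ zeroLocus g := by
  obtain ⟨z, hz, rfl⟩ := ha
  refine ⟨ClosedDisc.conj z, ?_, rfl⟩
  have h := (mem_realDiscAlgebra_iff.1 g.2).2 z
  rw [show g.1 z = 0 from hz] at h
  simpa using h.symm

/-- The real linear polynomial with root `a`, on the closed disc. -/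
noncomputable def linearFactor (a : ℝ) : realDiscAlgebra := coord - algebraMap ℝ _ a

/-- The real quadratic polynomial with roots `a` and `conj a`, on the closed disc. -/
noncomputable def quadraticFactor (a : ℂ) : realDiscAlgebra :=
  coord ^ 2 - algebraMap ℝ _ (2 * a.re) * coord + algebraMap ℝ _ (‖a‖ ^ 2)

theorem linearFactor_apply (a : ℝ) (z : ClosedDisc) : (linearFactor a).1 z = z - a := rfl

theorem quadraticFactor_apply (a : ℂ) (z : ClosedDisc) :
    (quadraticFactor a).1 z = (z - a) * (z - conj a) := by
  change (z : ℂ) ^ 2 - ((2 * a.re : ℝ) : ℂ) * z + ((‖a‖ ^ 2 : ℝ) : ℂ) = _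
  rw [← Complex.add_conj, Complex.ofReal_pow, ← Complex.mul_conj']
  ring

theorem continuous_linearFactor : Continuous linearFactor := by
  unfold linearFactor
  fun_prop

theorem continuous_quadraticFactor : Continuous quadraticFactor := by
  unfold quadraticFactor
  fun_prop

theorem linearFactor_mul_self (a : ℝ) : linearFactor a * linearFactor a = quadraticFactor a :=
  Subtype.ext <| ContinuousMap.ext fun z => by
    rw [quadraticFactor_apply, Complex.conj_ofReal]
    rfl

theorem ne_zero_of_linearFactor {g : realDiscAlgebra} {a : ℝ} (ha : (a : ℂ) ∉ zeroLocus g)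
    (z : ClosedDisc) (hz : (linearFactor a).1 z = 0) : g.1 z ≠ 0 := by
  rw [linearFactor_apply, sub_eq_zero] at hz
  rwa [← hz, coe_mem_zeroLocus] at ha

theorem ne_zero_of_quadraticFactor {g : realDiscAlgebra} {a : ℂ} (ha : a ∉ zeroLocus g)
    (z : ClosedDisc) (hz : (quadraticFactor a).1 z = 0) : g.1 z ≠ 0 := by
  rw [quadraticFactor_apply, mul_eq_zero, sub_eq_zero, sub_eq_zero] at hz
  rcases hz with hz | hz
  · rwa [← hz, coe_mem_zeroLocus] at ha
  · have ha' : conj a ∉ zeroLocus g := fun h => ha (by simpa using conj_mem_zeroLocus h)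
    rwa [← hz, coe_mem_zeroLocus] at ha'

theorem isUnit_linearFactor {a : ℝ} (ha : 1 < |a|) : IsUnit (linearFactor a) := by
  refine isUnit_of_forall_ne_zero _ fun z hz => ?_
  rw [linearFactor_apply, sub_eq_zero] at hz
  have := mem_closedBall_zero_iff.1 z.2
  rw [hz, Complex.norm_real] at this
  exact this.not_gt ha

theorem isUnit_quadraticFactor {a : ℂ} (ha : 1 < ‖a‖) : IsUnit (quadraticFactor a) := by
  refine isUnit_of_forall_ne_zero _ fun z hz => ?_
  have hz1 := mem_closedBall_zero_iff.1 z.2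
  rw [quadraticFactor_apply, mul_eq_zero, sub_eq_zero, sub_eq_zero] at hz
  rcases hz with hz | hz
  · rw [hz] at hz1
    exact hz1.not_gt ha
  · rw [hz, Complex.norm_conj] at hz1
    exact hz1.not_gt ha

/-- The points where the lifting fails form an open subset of the disc whose boundary consists of
zeros of `g`, so it is empty by the maximum principle. -/
theorem liftsToUnit_quadraticFactor {g : realDiscAlgebra} {a : ℂ} (ha : a ∉ zeroLocus g) :
    LiftsToUnit g (quadraticFactor a) := by
  by_contra hna
  set C : Set ℂ := {a | a ∉ zeroLocus g ∧ ¬LiftsToUnit g (quadraticFactor a)} with hC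
  have hloc {b : ℂ} (hb : b ∉ zeroLocus g) :
      ∀ᶠ c in 𝓝 b, (LiftsToUnit g (quadraticFactor c) ↔ LiftsToUnit g (quadraticFactor b)) :=
    (continuous_quadraticFactor.tendsto b).eventually
      (eventually_liftsToUnit_iff (ne_zero_of_quadraticFactor hb))
  have hopen : IsOpen C := isOpen_iff_mem_nhds.2 fun b hb => by
    filter_upwards [hloc hb.1, (isClosed_zeroLocus g).isOpen_compl.mem_nhds hb.1] with c hc hc'
    exact ⟨hc', fun h => hb.2 (hc.1 h)⟩
  have hsub : C ⊆ closedBall 0 1 := fun b hb => by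
    by_contra hb1
    rw [mem_closedBall_zero_iff, not_le] at hb1
    exact hb.2 (.of_isUnit (isUnit_quadraticFactor hb1))
  have hball : C ⊆ ball 0 1 := by
    rw [← interior_closedBall (0 : ℂ) one_ne_zero]
    exact interior_maximal hsub hopen
  -- At a frontier point off the zeros of `g`, local constancy would put the point into the open set
  -- `C` itself.
  have hfr : Set.EqOn (ClosedDisc.ext g.1) 0 (frontier C) := fun b hb => by
    rw [hopen.frontier_eq] at hb
    have hbZ : b ∈ zeroLocus g := by
      by_contra hbZ
      obtain ⟨c, hc, hcC⟩ := (mem_closure_iff_frequently.1 hb.1 |>.and_eventually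
        (hloc hbZ)).exists
      exact hb.2 ⟨hbZ, fun h => hc.2 (hcC.2 h)⟩
    obtain ⟨z, hz, rfl⟩ := hbZ
    exact (ClosedDisc.ext_apply g.1 z).trans hz
  have hdiff : DiffContOnCl ℂ (ClosedDisc.ext g.1) C :=
    ⟨DifferentiableOn.mono (mem_realDiscAlgebra_iff.1 g.2).1 hball,
      (ClosedDisc.continuousOn_ext g.1).mono (closure_minimal hsub isClosed_closedBall)⟩
  have h0 := Complex.eqOn_of_eqOn_frontier (isBounded_ball.subset hball) hdiff
    diffContOnCl_const hfr ⟨ha, hna⟩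
  exact ha ⟨⟨a, hsub ⟨ha, hna⟩⟩, (ClosedDisc.ext_apply g.1 _).symm.trans h0, rfl⟩

/-- The root slides left along the real line until it leaves the disc. -/
theorem liftsToUnit_linearFactor_of_forall_le {g : realDiscAlgebra} {a : ℝ}
    (h : ∀ x : ℝ, x ≤ a → (x : ℂ) ∉ zeroLocus g) : LiftsToUnit g (linearFactor a) := by
  refine (liftsToUnit_iff_of_isPreconnected isPreconnected_Iic continuous_linearFactor
    (fun x hx => ne_zero_of_linearFactor (h x hx)) (Set.mem_Iic.2 le_rfl)
    (Set.mem_Iic.2 (min_le_left a (-2)))).2 (.of_isUnit (isUnit_linearFactor ?_))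
  exact lt_abs.2 (.inr (by linarith [min_le_right a (-2)]))

theorem liftsToUnit_linearFactor_of_forall_ge {g : realDiscAlgebra} {a : ℝ}
    (h : ∀ x : ℝ, a ≤ x → (x : ℂ) ∉ zeroLocus g) : LiftsToUnit g (linearFactor a) := by
  refine (liftsToUnit_iff_of_isPreconnected isPreconnected_Ici continuous_linearFactor
    (fun x hx => ne_zero_of_linearFactor (h x hx)) (Set.mem_Ici.2 le_rfl)
    (Set.mem_Ici.2 (le_max_left a 2))).2 (.of_isUnit (isUnit_linearFactor ?_))
  exact lt_abs.2 (.inl (by linarith [le_max_right a 2]))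

/-- The root `b` slides to `a`, where the double root is a quadratic factor. -/
theorem liftsToUnit_linearFactor_mul {g : realDiscAlgebra} {a b : ℝ} (hab : a ≤ b)
    (h : ∀ x ∈ Set.Icc a b, (x : ℂ) ∉ zeroLocus g) :
    LiftsToUnit g (linearFactor a * linearFactor b) := by
  have ha := h a (Set.left_mem_Icc.2 hab)
  refine (liftsToUnit_iff_of_isPreconnected (γ := fun x => linearFactor a * linearFactor x)
    isPreconnected_Icc (continuous_const.mul continuous_linearFactor) (fun x hx z hz => ?_)
    (Set.left_mem_Icc.2 hab) (Set.right_mem_Icc.2 hab)).1 ?_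
  · rcases mul_eq_zero.1 (show (linearFactor a).1 z * (linearFactor x).1 z = 0 from hz) with hz | hz
    · exact ne_zero_of_linearFactor ha z hz
    · exact ne_zero_of_linearFactor (h x hx) z hz
  · rw [linearFactor_mul_self]
    exact liftsToUnit_quadraticFactor ha

/-! ### Real polynomials -/

open Polynomial in
theorem liftsToUnit_aeval_coord {g : realDiscAlgebra} (p : ℝ[X]) (hp0 : p ≠ 0)
    (hp : ∀ a ∈ zeroLocus g, aeval a p ≠ 0)
    (hsign : ∀ x y : ℝ, (x : ℂ) ∈ zeroLocus g → (y : ℂ) ∈ zeroLocus g →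
      0 < p.eval x * p.eval y) :
    LiftsToUnit g (aeval coord p) := by
  induction hn : p.natDegree using Nat.strong_induction_on generalizing p with
  | _ n ih =>
  subst hn
  -- A lifting factor `s` of constant sign at the real zeros of `g` can be split off: the cofactor
  -- inherits the sign condition.
  have step (s q : ℝ[X]) (hsq : p = s * q) (hs : 0 < s.natDegree)
      (hlift : LiftsToUnit g (aeval coord s))
      (hss : ∀ x y : ℝ, (x : ℂ) ∈ zeroLocus g → (y : ℂ) ∈ zeroLocus g →
        0 < s.eval x * s.eval y) : LiftsToUnit g (aeval coord p) := by
    have hq0 : q ≠ 0 := right_ne_zero_of_mul (hsq ▸ hp0)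
    have hs0 : s ≠ 0 := left_ne_zero_of_mul (hsq ▸ hp0)
    rw [hsq, map_mul]
    refine hlift.mul (ih _ ?_ q hq0 (fun a ha h0 => hp a ha ?_) (fun x y hx hy => ?_) rfl)
    · rw [hsq, natDegree_mul hs0 hq0]
      omega
    · rw [hsq, map_mul, h0, mul_zero]
    · have := hsign x y hx hy
      rw [hsq, eval_mul, eval_mul, mul_mul_mul_comm] at this
      exact (pos_iff_pos_of_mul_pos this).1 (hss x y hx hy)
  have hpR (x : ℝ) (hx : (x : ℂ) ∈ zeroLocus g) : p.eval x ≠ 0 := fun h0 => by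
    refine hp x hx ?_
    have := aeval_algebraMap_apply_eq_algebraMap_eval (A := ℂ) x p
    rwa [h0, map_zero] at this
  by_cases hdeg : p.natDegree = 0
  · obtain ⟨c, rfl⟩ := natDegree_eq_zero.1 hdeg
    rw [aeval_C]
    exact .of_isUnit ((IsUnit.mk0 c fun hc => hp0 (by rw [hc, C_0])).map _)
  by_cases hroot : ∃ w : ℂ, aeval w p = 0 ∧ w.im ≠ 0
  · obtain ⟨w, hw, hw'⟩ := hroot
    obtain ⟨q, hq⟩ := p.quadratic_dvd_of_aeval_eq_zero_im_ne_zero hw hw'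
    refine step _ q hq ?_ ?_ fun x y _ _ => ?_
    · have : (X ^ 2 - C (2 * w.re) * X + C (‖w‖ ^ 2) : ℝ[X]).natDegree = 2 := by compute_degree!
      omega
    · simpa [quadraticFactor] using
        liftsToUnit_quadraticFactor fun h : w ∈ zeroLocus g => hp w h hw
    · have hpos (x : ℝ) : 0 < (X ^ 2 - C (2 * w.re) * X + C (‖w‖ ^ 2) : ℝ[X]).eval x := by
        have h1 : 0 < w.im ^ 2 := by positivity
        simp only [eval_add, eval_sub, eval_mul, eval_pow, eval_X, eval_C, Complex.sq_norm,
          Complex.normSq_apply]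
        nlinarith [sq_nonneg (x - w.re)]
      exact mul_pos (hpos x) (hpos y)
  push Not at hroot
  have aeval_lin (a : ℝ) : aeval coord (X - C a) = linearFactor a := by
    simp [linearFactor]
  have least (q : ℝ[X]) (hq : q ≠ 0) {x : ℝ} (hx : q.IsRoot x) :
      ∃ a, q.IsRoot a ∧ ∀ b, q.IsRoot b → a ≤ b := by
    have hne : q.roots.toFinset.Nonempty := ⟨x, by simp [hq, hx.eq_zero]⟩
    refine ⟨q.roots.toFinset.min' hne, ?_, fun b hb => Finset.min'_le _ _ ?_⟩
    · have := Finset.min'_mem _ hne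
      rw [Multiset.mem_toFinset, mem_roots hq] at this
      exact this
    · rwa [Multiset.mem_toFinset, mem_roots hq]
  obtain ⟨w, hw⟩ := IsAlgClosed.exists_aeval_eq_zero ℂ p
    (mt (fun h => natDegree_eq_of_degree_eq_some h) hdeg)
  have hwr : p.IsRoot w.re := by
    have hw2 : w = (w.re : ℂ) := Complex.ext rfl (hroot w hw)
    rw [hw2, show ((w.re : ℝ) : ℂ) = algebraMap ℝ ℂ w.re from rfl,
      aeval_algebraMap_apply_eq_algebraMap_eval, map_eq_zero] at hw
    exact hw
  obtain ⟨a, ha, hmin⟩ := least p hp0 hwr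
  obtain ⟨q, hq⟩ := dvd_iff_isRoot.2 ha
  have hq0 : q ≠ 0 := right_ne_zero_of_mul (hq ▸ hp0)
  by_cases hleft : ∀ x : ℝ, x ≤ a → (x : ℂ) ∉ zeroLocus g
  · refine step _ q hq (by simp) ?_ fun x y hx hy => ?_
    · rw [aeval_lin]
      exact liftsToUnit_linearFactor_of_forall_le hleft
    · have h1 := not_le.1 fun h => hleft x h hx
      have h2 := not_le.1 fun h => hleft y h hy
      simpa using mul_pos (sub_pos.2 h1) (sub_pos.2 h2)
  by_cases hright : ∀ x : ℝ, a ≤ x → (x : ℂ) ∉ zeroLocus g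
  · refine step _ q hq (by simp) ?_ fun x y hx hy => ?_
    · rw [aeval_lin]
      exact liftsToUnit_linearFactor_of_forall_ge hright
    · have h1 := not_le.1 fun h => hright x h hx
      have h2 := not_le.1 fun h => hright y h hy
      simpa using mul_pos_of_neg_of_neg (sub_neg.2 h1) (sub_neg.2 h2)
  push Not at hleft hright
  obtain ⟨x, hxa, hx⟩ := hleft
  obtain ⟨y, hay, hy⟩ := hright
  have hne (t : ℝ) (ht : (t : ℂ) ∈ zeroLocus g) : t ≠ a := fun h => hpR t ht (h ▸ ha)
  replace hxa := lt_of_le_of_ne hxa (hne x hx)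
  -- Otherwise `p` would change sign exactly once between the zeros `x` and `y` of `g`.
  have hqroot (y : ℝ) (hy : (y : ℂ) ∈ zeroLocus g) (hay : a ≤ y) : ∃ b ≤ y, q.IsRoot b := by
    by_contra! hno
    replace hay := lt_of_le_of_ne hay (hne y hy).symm
    have hprod := hsign x y hx hy
    rw [hq, eval_mul, eval_mul, mul_mul_mul_comm] at hprod
    have hlin : (X - C a).eval x * (X - C a).eval y < 0 := by
      simpa using mul_neg_of_neg_of_pos (sub_neg.2 hxa) (sub_pos.2 hay)
    have hqneg : q.eval x * q.eval y < 0 := by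
      by_contra! h
      exact hprod.not_ge (mul_nonpos_of_nonpos_of_nonneg hlin.le h)
    have hmem : (0 : ℝ) ∈ Set.uIcc (q.eval x) (q.eval y) := by
      rw [Set.mem_uIcc]
      rcases mul_neg_iff.1 hqneg with h | h
      · exact .inr ⟨h.2.le, h.1.le⟩
      · exact .inl ⟨h.1.le, h.2.le⟩
    obtain ⟨t, ht, ht0⟩ := intermediate_value_uIcc q.continuous.continuousOn hmem
    rw [Set.uIcc_of_le (hxa.trans hay).le] at ht
    exact hno t ht.2 ht0
  obtain ⟨b', -, hb'⟩ := hqroot y hy hay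
  -- `b` is the next root of `p` counted with multiplicity, so `b = a` is allowed.
  obtain ⟨b, hb, hbmin⟩ := least q hq0 hb'
  have hpb : p.IsRoot b := by rw [hq]; exact root_mul_left_of_isRoot _ hb
  have hab := hmin b hpb
  -- A zero `t` of `g` here forces a root of `q` at most `t`, hence `t = b`; but `p` has no root at
  -- a zero of `g`.
  have hIcc (t : ℝ) (ht : t ∈ Set.Icc a b) : (t : ℂ) ∉ zeroLocus g := fun htZ => by
    obtain ⟨c, hct, hc⟩ := hqroot t htZ ht.1
    have : t = b := le_antisymm ht.2 ((hbmin c hc).trans hct)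
    exact hpR t htZ (this ▸ hpb)
  obtain ⟨r, hr⟩ := dvd_iff_isRoot.2 hb
  refine step ((X - C a) * (X - C b)) r (by rw [hq, hr, mul_assoc]) ?_ ?_ fun x y hx hy => ?_
  · rw [natDegree_mul (X_sub_C_ne_zero a) (X_sub_C_ne_zero b)]
    simp
  · rw [map_mul, aeval_lin, aeval_lin]
    exact liftsToUnit_linearFactor_mul hab hIcc
  · have hpos (t : ℝ) (ht : (t : ℂ) ∈ zeroLocus g) :
        0 < ((X - C a) * (X - C b)).eval t := by
      have : ¬(a ≤ t ∧ t ≤ b) := fun h => hIcc t h ht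
      simp only [eval_mul, eval_sub, eval_X, eval_C]
      by_cases h : a ≤ t
      · have h2 : b < t := not_le.1 fun h2 => this ⟨h, h2⟩
        exact mul_pos (sub_pos.2 (hab.trans_lt h2)) (sub_pos.2 h2)
      · have h2 := not_le.1 h
        exact mul_pos_of_neg_of_neg (sub_neg.2 h2) (sub_neg.2 (h2.trans_le hab))
    exact mul_pos (hpos x hx) (hpos y hy)

/-! ### From polynomials to the real disc algebra -/

theorem im_apply_eq_zero (f : realDiscAlgebra) {z : ClosedDisc} (hz : (z : ℂ).im = 0) :
    (f.1 z).im = 0 := by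
  have h := (mem_realDiscAlgebra_iff.1 f.2).2 z
  rw [show ClosedDisc.conj z = z from Subtype.ext (Complex.conj_eq_iff_im.2 hz)] at h
  exact Complex.conj_eq_iff_im.1 h.symm

theorem liftsToUnit_of_isPOZ {f g : realDiscAlgebra} {δ : ℝ} (hδ : 0 < δ)
    (hf : ∀ z, g.1 z = 0 → δ ≤ ‖f.1 z‖) (hpoz : IsPOZ f g) : LiftsToUnit g f := by
  by_cases hg : ∀ z, g.1 z ≠ 0
  · exact .of_isUnit_modulus (isUnit_of_forall_ne_zero g hg)
  push Not at hg
  obtain ⟨z₀, hz₀⟩ := hg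
  have hfg (z : ClosedDisc) (hz : f.1 z = 0) : g.1 z ≠ 0 := fun h => by
    have := hf z h
    rw [hz, norm_zero] at this
    exact this.not_gt hδ
  obtain ⟨ε, hε, hball⟩ := Metric.eventually_nhds_iff_ball.1 (eventually_liftsToUnit_iff hfg)
  -- Closeness `ε / 2` preserves the lifting property; closeness `δ` preserves nonvanishing at the
  -- zeros of `g` and the sign at the real ones.
  obtain ⟨p, hp⟩ := exists_real_polynomial_near f (lt_min (half_pos hε) hδ)
  have hpε : Polynomial.aeval coord p ∈ ball f ε := by
    rw [mem_ball_iff_norm']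
    refine lt_of_le_of_lt ((ContinuousMap.norm_le _ (half_pos hε).le).2 fun z => ?_)
      (half_lt_self hε)
    have := ((hp z).trans_le (min_le_left _ _)).le
    rwa [← aeval_coord_apply] at this
  have hpδ (z : ClosedDisc) := (hp z).trans_le (min_le_right _ _)
  have hp0 (a : ℂ) (ha : a ∈ zeroLocus g) : Polynomial.aeval a p ≠ 0 := by
    obtain ⟨z, hz, rfl⟩ := ha
    intro h0
    have h1 := hpδ z
    rw [h0, sub_zero] at h1
    exact (hf z hz).not_gt h1
  have hsgn (z : ClosedDisc) (x : ℝ) (hzx : (z : ℂ) = x) (hz : g.1 z = 0) :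
      SignType.sign (p.eval x) = SignType.sign (f.1 z).re := by
    have him := im_apply_eq_zero f (z := z) (by rw [hzx, Complex.ofReal_im])
    have hre : f.1 z = ((f.1 z).re : ℂ) := Complex.ext rfl him
    have h1 := hpδ z
    have h2 := hf z hz
    have h3 : Polynomial.aeval (z : ℂ) p = ((p.eval x : ℝ) : ℂ) := by
      rw [hzx]
      exact Polynomial.aeval_algebraMap_apply_eq_algebraMap_eval x p
    rw [h3, hre, ← Complex.ofReal_sub, Complex.norm_real, Real.norm_eq_abs, abs_lt] at h1
    rw [hre, Complex.norm_real, Real.norm_eq_abs] at h2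
    rcases le_abs.1 h2 with h | h
    · rw [sign_pos (by linarith), sign_pos (by linarith)]
    · rw [sign_neg (by linarith), sign_neg (by linarith)]
  refine (hball _ hpε).1 (liftsToUnit_aeval_coord p ?_ hp0 ?_)
  · rintro rfl
    exact hp0 z₀ (coe_mem_zeroLocus.2 hz₀) (map_zero _)
  · rintro x y ⟨z, hz, hzx⟩ ⟨w, hw, hwy⟩
    have heq : SignType.sign (p.eval x) = SignType.sign (p.eval y) := by
      rw [hsgn z x hzx hz, hsgn w y hwy hw]
      exact hpoz z w (by rw [hzx, Complex.ofReal_im]) (by rw [hwy, Complex.ofReal_im]) hz hw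
    have hx0 : p.eval x ≠ 0 := fun h0 => hp0 z ⟨z, hz, rfl⟩ (by
      rw [hzx]
      exact (Polynomial.aeval_algebraMap_apply_eq_algebraMap_eval x p).trans (by rw [h0, map_zero]))
    rw [← sign_eq_one_iff, sign_mul, ← heq]
    rcases lt_or_gt_of_ne hx0 with h | h
    · rw [sign_neg h]; rfl
    · rw [sign_pos h]; rfl

end realDiscAlgebra

theorem theorem1p2 (f₁ f₂ : realDiscAlgebra)
    (hf₁ : ‖(f₁ : C(ClosedDisc, ℂ))‖ ≤ 1) (hf₂ : ‖(f₂ : C(ClosedDisc, ℂ))‖ ≤ 1)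
    (δ : ℝ) (hδ : 0 < δ) (hinf : δ ≤ ⨅ z : ClosedDisc, (‖f₁.1 z‖ + ‖f₂.1 z‖))
    (hpoz : IsPOZ f₁ f₂) :
    ∃ g₁ g₂ : realDiscAlgebra, IsUnit g₁ ∧
      ∀ z : ClosedDisc, f₁.1 z * g₁.1 z + f₂.1 z * g₂.1 z = 1 := by
  have hbdd : BddBelow (Set.range fun z : ClosedDisc => ‖f₁.1 z‖ + ‖f₂.1 z‖) :=
    ⟨0, by rintro _ ⟨z, rfl⟩; positivity⟩
  have hlow (z : ClosedDisc) (hz : f₂.1 z = 0) : δ ≤ ‖f₁.1 z‖ := by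
    simpa [hz] using hinf.trans (ciInf_le hbdd z)
  obtain ⟨k, hk⟩ := realDiscAlgebra.liftsToUnit_of_isPOZ hδ hlow hpoz
  obtain ⟨v, hv⟩ := hk.exists_right_inv
  refine ⟨v, k * v, IsUnit.of_mul_eq_one_right _ hv, fun z => ?_⟩
  have h : f₁ * v + f₂ * (k * v) = 1 := by rw [← hv]; ring
  exact DFunLike.congr_fun (congrArg Subtype.val h) z
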